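/- **Setting.** Let $S$ be a set of states with start state $s_0$ and goal set $\mathcal S^g$. In each state $s$ a finite set $A(s)$ of parameterized actions is generated whose skill preconditions hold at $s$. There are models $M_0,\dots,M_K$ (slowest to fastest) predicting next states $M_i(s,a)$, preconditions $\mathrm{pre}(M_i)\subseteq S\times\mathrm{Act}$, a cost $c(s,a,s')$, a heuristic $h\ge 0$, a factor $\epsilon$ and positive weights $w=(w_0,\dots,w_K)$. There is an edge from $s$ to $s'$ by $a$ iff $a\in A(s)$ and $s'=M_i(s,a)$ for some $i$ with $(s,a)\in\mathrm{pre}(M_i)$; $g^*(t)\in[0,\infty]$ is the infimum of the costs of the paths from $s_0$ to $t$. **Planner (multi-queue weighted A* with Prioritized Expansion).** It keeps shared values $g$ (initially $g(s_0)=0$, and $\infty$ elsewhere), shared sets $A_{inc}(s)$ of saved actions (initially $\emptyset$), open queues $\mathrm{OPEN}_0,\dots,\mathrm{OPEN}_K$ (initially $\{s_0\}$) and closed sets $\mathrm{CLOSED}_0,\dots,\mathrm{CLOSED}_K$ (initially $\emptyset$). The priority of $s$ is $f(s)=g(s)+\epsilon h(s)$, and $\mathrm{MinKey}_i$ is the least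 priority in $\mathrm{OPEN}_i$ ($\infty$ if it is empty). While some queue is nonempty, choose $i$ minimizing $w_i\,\mathrm{MinKey}_i$ and remove a state $s$ of least priority from $\mathrm{OPEN}_i$ (ties are broken arbitrarily). - If $s\in\mathcal S^g$, return $s_g=s$. Otherwise let $A=A_{inc}(s)$ if this set is nonempty, and $A=A(s)$ if it is empty. - If $i=0$ (full expansion), add $s$ to all closed sets; each $a\in A$ with $(s,a)\in\bigcup_j\mathrm{pre}(M_j)$ yields the successor $M_j(s,a)$ for the largest such $j$. - If $i>0$ (partial expansion), add $s$ to $\mathrm{CLOSED}_i$; each $a\in A$ with $(s,a)\in\mathrm{pre}(M_i)$ yields the successor $M_i(s,a)$, and the other $a\in A$ are added to $A_{inc}(s)$. - For each successor $s'$ obtained from an action $a$, set $A_{inc}(s')=\emptyset$; if $s'$ is missing from some closed set and $g(s')>g(s)+c(s,a,s')$, set $g(s')=g(s)+c(s,a,s')$ and add $s'$ to all open queues. **Assumptions.** (1) $M_i(s,a)=M_j(s,a)$ whenever $(s,a)\in\mathrm{pre}(M_i)\cap\mathrm{pre}(M_j)$; (2) $\epsilon>1$; (3) $w_i\ge w_j$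 for $i<j$; (4) $h$ is admissible (it never exceeds the optimal cost from $s$ to any goal) and consistent ($h(s)\le c(s,a,s')+h(s')$ on every edge); (5) $c\ge 0$; (6) transitions outside every $\mathrm{pre}(M_i)$ are not edges (infinite cost). **Theorem 2.** If the planner terminates by returning a goal $s_g$, then at that moment $g(s_g)$ is the cost of a path from $s_0$ to $s_g$, and $$g(s_g)\le \frac{w_0}{\min(w)}\,\epsilon\, g^*(s_g),\qquad\text{and also}\qquad g(s_g)\le \frac{w_0}{\min(w)}\,\epsilon\, g^*(t)\quad\text{for every goal } t\in\mathcal S^g .$$ If it terminates because all open queues are empty, then no goal is reachable: $g^*(t)=\infty$ for every $t\in\mathcal S^g$. -/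

import Mathlib

open scoped NNReal ENNReal

/-- The input of the planner. There are `K + 1` models `model 0, …, model K`, listed from slowest to
fastest, with one open queue per model; queue `0` belongs to the anchor search.
Costs and heuristic values are nonnegative reals. -/
structure PlanningProblem (S Act : Type*) (K : ℕ) where
  /-- the start state -/
  start : S
  /-- the goal set -/
  goal : Set S
  /-- the candidate parameterized actions produced by the skills' parameter generators -/
  params : S → Finset Act
  /-- the states in which a (parameterized) skill can be executed -/
  skillPre : Act → Set S
  /-- the predicted next state `M_i(s, a)` -/
  model : Fin (K + 1) → S → Act → S
  /-- the model precondition `pre(M_i)`: the pairs `(s, a)` on which `M_i` is deemed accurate -/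
  modelPre : Fin (K + 1) → Set (S × Act)
  /-- the cost `c(s, a, s')` -/
  cost : S → Act → S → ℝ≥0
  /-- the heuristic -/
  h : S → ℝ≥0
  /-- the inflation factor of weighted A* -/
  ε : ℝ≥0
  /-- the model weights -/
  w : Fin (K + 1) → ℝ≥0

namespace PlanningProblem

variable {S Act : Type*} {K : ℕ} (P : PlanningProblem S Act K)

/-! ### The graph that is searched -/

open scoped Classical in
/-- The generated actions that satisfy the skill precondition at `s`. -/
noncomputable def candidates (s : S) : Finset Act :=
  (P.params s).filter fun a => s ∈ P.skillPre a

/-- The action `a` leads from `s` to `s'`. The edge exists only if at least one model is accurate at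
`(s, a)` (equivalently, every other transition has infinite cost). -/
def Edge (s : S) (a : Act) (s' : S) : Prop :=
  a ∈ P.candidates s ∧ ∃ i, (s, a) ∈ P.modelPre i ∧ P.model i s a = s'

/-- `P.PathCost s t x`: some path of the graph leads from `s` to `t` and has total cost `x`. -/
inductive PathCost : S → S → ℝ≥0 → Prop
  | nil (s : S) : PathCost s s 0
  | snoc {s t u : S} {x : ℝ≥0} {a : Act} :
      PathCost s t x → P.Edge t a u → PathCost s u (x + P.cost t a u)

/-- The infimum of the costs of the paths from `s` to `t`; it is `∞` if there is no path. -/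
noncomputable def dist (s t : S) : ℝ≥0∞ :=
  ⨅ (x : ℝ≥0) (_ : P.PathCost s t x), (x : ℝ≥0∞)

/-- The optimal cost `g*(t)` of reaching `t` from the start state. -/
noncomputable def gStar (t : S) : ℝ≥0∞ := P.dist P.start t

/-- `h` never overestimates the cost of reaching a goal. -/
def Admissible : Prop := ∀ s, ∀ t ∈ P.goal, (P.h s : ℝ≥0∞) ≤ P.dist s t

/-- The triangle inequality of `h` along the edges. -/
def Consistent : Prop := ∀ s a s', P.Edge s a s' → P.h s ≤ P.cost s a s' + P.h s'

/-- Any two models that are accurate at `(s, a)` predict the same state. -/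
def ModelsAgree : Prop :=
  ∀ i j s a, (s, a) ∈ P.modelPre i → (s, a) ∈ P.modelPre j → P.model i s a = P.model j s a

/-- The smallest weight. -/
noncomputable def minWeight : ℝ≥0 := Finset.univ.inf' Finset.univ_nonempty P.w

/-! ### The multi-queue planner -/

variable (S Act K) in
/-- The memory of the planner. The cost values `g` and the sets `inc` (the unevaluated actions
`A_inc` of a node) are shared by all the searches; each search has its own open queue and closed
set. -/
structure SearchState where
  g : S → ℝ≥0∞
  inc : S → Finset Act
  opened : Fin (K + 1) → Set S
  closed : Fin (K + 1) → Set S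

open scoped Classical in
/-- Initially all open queues hold just the start state, and all closed sets are empty. -/
noncomputable def init : SearchState S Act K where
  g := Function.update (fun _ => ∞) P.start 0
  inc := fun _ => ∅
  opened := fun _ => {P.start}
  closed := fun _ => ∅

/-- The priority `f = g + ε h`. -/
noncomputable def key (σ : SearchState S Act K) (s : S) : ℝ≥0∞ := σ.g s + P.ε * P.h s

/-- The lowest priority in the queue `i` (`∞` for an empty queue). -/
noncomputable def minKey (σ : SearchState S Act K) (i : Fin (K + 1)) : ℝ≥0∞ :=
  ⨅ s ∈ σ.opened i, P.key σ s

/-- The planner may take `s` from the queue `i` next: `i` minimizes the weighted smallest priority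
and `s` has the smallest priority in the queue `i`. Ties may be broken in any way. -/
def Selects (σ : SearchState S Act K) (i : Fin (K + 1)) (s : S) : Prop :=
  s ∈ σ.opened i ∧ P.key σ s = P.minKey σ i ∧
    ∀ j, (P.w i : ℝ≥0∞) * P.minKey σ i ≤ P.w j * P.minKey σ j

open scoped Classical in
/-- The actions that are considered when `s` is expanded: the saved ones if there are any, and
otherwise the newly generated ones. -/
noncomputable def actions (σ : SearchState S Act K) (s : S) : Finset Act :=
  if (σ.inc s).Nonempty then σ.inc s else P.candidates s

open scoped Classical in
/-- The models that are accurate at `(s, a)`. -/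
noncomputable def accurate (s : S) (a : Act) : Finset (Fin (K + 1)) :=
  Finset.univ.filter fun i => (s, a) ∈ P.modelPre i

open scoped Classical in
/-- Full expansion (prioritized selection): the successor is computed by the fastest accurate model,
and there is none if no model is accurate. -/
noncomputable def fullSucc (s : S) (a : Act) : Option S :=
  if hne : s ∈ P.skillPre a ∧ (P.accurate s a).Nonempty then
    some (P.model ((P.accurate s a).max' hne.2) s a)
  else none

open scoped Classical in
/-- Partial expansion with the model `i`: there is a successor only if this model is accurate. -/
noncomputable def partialSucc (i : Fin (K + 1)) (s : S) (a : Act) : Option S :=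
  if (s, a) ∈ P.modelPre i then some (P.model i s a) else none

/-- The successor of `s` by `a` in an expansion from the queue `i`. -/
noncomputable def succ (i : Fin (K + 1)) (s : S) (a : Act) : Option S :=
  if i = 0 then P.fullSucc s a else P.partialSucc i s a

open scoped Classical in
/-- Bookkeeping of an expansion of `s` from the queue `i`, before the successors are processed:
`s` leaves the open queue `i`. A full expansion (`i = 0`) puts `s` into all closed sets; a partial
one puts `s` into the closed set `i` and saves the actions outside `pre(M_i)`. -/
noncomputable def prepare (σ : SearchState S Act K) (i : Fin (K + 1)) (s : S) :
    SearchState S Act K where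
  g := σ.g
  inc :=
    if i = 0 then σ.inc
    else Function.update σ.inc s
      (σ.inc s ∪ (P.actions σ s).filter fun a => (s, a) ∉ P.modelPre i)
  opened := Function.update σ.opened i (σ.opened i \ {s})
  closed :=
    if i = 0 then fun j => insert s (σ.closed j)
    else Function.update σ.closed i (insert s (σ.closed i))

open scoped Classical in
/-- Process the successor `s'` of `s` by the action `a`. If `s'` is missing from some closed set and
the path through `s` is strictly cheaper, then `g(s')` is lowered and `s'` is put into all open
queues. (In a loop over the closed sets the strict test can succeed only once, whence `∃`.) -/
noncomputable def relax (s : S) (σ : SearchState S Act K) (e : Act × S) : SearchState S Act K :=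
  if (∃ i, e.2 ∉ σ.closed i) ∧ σ.g s + P.cost s e.1 e.2 < σ.g e.2 then
    { g := Function.update σ.g e.2 (σ.g s + P.cost s e.1 e.2)
      inc := Function.update σ.inc e.2 ∅
      opened := fun i => insert e.2 (σ.opened i)
      closed := σ.closed }
  else
    { σ with inc := Function.update σ.inc e.2 ∅ }

/-- Expand `s` from the queue `i`, going through the actions in the order of the list `l`. -/
noncomputable def expand (σ : SearchState S Act K) (i : Fin (K + 1)) (s : S) (l : List Act) :
    SearchState S Act K :=
  (l.filterMap fun a => (P.succ i s a).map fun s' => (a, s')).foldl (P.relax s) (P.prepare σ i s)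

/-- One iteration of the main loop in which the selected state is not a goal. The actions may be
processed in any order. -/
def Step (σ σ' : SearchState S Act K) : Prop :=
  ∃ i s l, P.Selects σ i s ∧ s ∉ P.goal ∧
    l.Nodup ∧ (∀ a, a ∈ l ↔ a ∈ P.actions σ s) ∧ σ' = P.expand σ i s l

/-- The search states that occur at the beginning of an iteration in some run of the planner. -/
def Occurs (σ : SearchState S Act K) : Prop := Relation.ReflTransGen P.Step P.init σ

/-- Some run of the planner terminates in the search state `σ` by returning the goal state `sg`,
which was selected for expansion. -/
def Returns (σ : SearchState S Act K) (sg : S) : Prop :=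
  P.Occurs σ ∧ (∃ i, P.Selects σ i sg) ∧ sg ∈ P.goal

/-- Some run of the planner terminates in the search state `σ` because all open queues are empty. -/
def Exhausts (σ : SearchState S Act K) : Prop := P.Occurs σ ∧ ∀ i, σ.opened i = ∅

end PlanningProblem

/-!
Queue `0` alone already behaves like weighted A* without reopenings: a state with a finite value `g`
stays in the open queue `0` until it is expanded fully, and once expanded it lies in all closed
sets, so that its value is frozen. The partial expansions from the other queues can only lower the
values of states that have not been expanded fully. An action missing from a nonempty saved set has
been processed with the current value `g(s)`, because lowering `g(s)` empties that set; hence all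
edges out of `s` have been relaxed with its final value once `s` has been expanded fully.

The structure `Invariant` collects these facts. Its main consequence is
`Invariant.exists_opened_key_le`: on every path from the start to a state `s` that has not been
expanded fully, let `u` be the state after the last fully expanded one (or the start, if there is
none). Then `u` lies in the open queue `0`, and `g(u) + ε h(u) ≤ ε (x + h(s))`, where `x` is the
cost of the path. This bound yields `g(s) ≤ ε x` when `s` has the least priority in the queue `0`,
which keeps the invariant alive (`Invariant.step`). For a goal `s` it says `MinKey₀ ≤ ε x`, because a goal is never expanded and
`h` vanishes at it. A goal returned from the queue `i` has a priority that is at most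
`(w₀ / wᵢ) MinKey₀`, hence the bound of the theorem; and if the queue `0` is empty, there is no path
to a goal.
-/

namespace PlanningProblem

variable {S Act : Type*} {K : ℕ} {P : PlanningProblem S Act K}

/-! ### The invariant of the search -/

/-- The invariant of the search while the successors `l` of the state `s` are still to be processed.
At the beginning of an iteration `l` is empty, and then `s` plays no role. A state has been expanded
fully if and only if it is in the closed set `0`. -/
structure Invariant (P : PlanningProblem S Act K) (s : S) (l : List (Act × S))
    (σ : SearchState S Act K) : Prop where
  /-- finite values are costs of paths -/
  pathCost : ∀ t x, σ.g t = (x : ℝ≥0) → P.PathCost P.start t x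
  start_eq : σ.g P.start = 0
  opened_ne_top : ∀ i, ∀ t ∈ σ.opened i, σ.g t ≠ ∞
  mem_opened : ∀ t, σ.g t ≠ ∞ → t ∉ σ.closed 0 → t ∈ σ.opened 0
  not_mem_closed : ∀ t ∈ σ.opened 0, t ∉ σ.closed 0
  mem_closed : ∀ t ∈ σ.closed 0, ∀ i, t ∈ σ.closed i
  /-- weighted A* expands states with `ε`-optimal values only -/
  closed_le : ∀ t ∈ σ.closed 0, ∀ x, P.PathCost P.start t x → σ.g t ≤ P.ε * x
  goal_not_mem : ∀ t ∈ P.goal, t ∉ σ.closed 0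
  inc_subset : ∀ t, σ.inc t ⊆ P.candidates t
  /-- every edge out of a fully expanded state has been relaxed or is still to be processed -/
  relaxed_of_closed : ∀ t ∈ σ.closed 0, ∀ a u, P.Edge t a u → u ∉ σ.closed 0 →
    (t = s ∧ (a, u) ∈ l) ∨ σ.g u ≤ σ.g t + P.cost t a u
  /-- so has every edge out of a partially expanded state whose action is not saved -/
  relaxed_of_inc : ∀ t, (σ.inc t).Nonempty → ∀ a ∉ σ.inc t, ∀ u, P.Edge t a u →
    u ∉ σ.closed 0 → (t = s ∧ (a, u) ∈ l) ∨ σ.g u ≤ σ.g t + P.cost t a u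
  edge_of_mem : ∀ e ∈ l, P.Edge s e.1 e.2

theorem invariant_init (s : S) : P.Invariant s [] P.init := by
  classical
  have hg : ∀ t, P.init.g t ≠ ∞ → t = P.start := by
    intro t ht
    by_contra hne
    exact ht (by simp [init, Function.update_of_ne hne])
  have h0 : P.init.g P.start = 0 := by simp [init]
  refine ⟨?_, h0, ?_, ?_, ?_, ?_, ?_, ?_, ?_, ?_, ?_, ?_⟩
  · intro t x hx
    obtain rfl := hg t (by simp [hx])
    rw [h0] at hx
    obtain rfl : x = 0 := by exact_mod_cast hx.symm
    exact .nil _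
  · rintro i t rfl
    simp [h0]
  · intro t ht _
    exact hg t ht
  all_goals simp [init]

/-- Nothing is pending at the beginning of an iteration, so any state may serve as the parameter. -/
theorem Invariant.change {s : S} {σ : SearchState S Act K} (H : P.Invariant s [] σ) (s' : S) :
    P.Invariant s' [] σ :=
  { H with
    relaxed_of_closed := fun t ht a u he hu =>
      .inr ((H.relaxed_of_closed t ht a u he hu).resolve_left (by simp))
    relaxed_of_inc := fun t ht a ha u he hu =>
      .inr ((H.relaxed_of_inc t ht a ha u he hu).resolve_left (by simp))
    edge_of_mem := by simp }

/-- The least priority in the queue `0` is bounded along every path to a state that has not been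
expanded fully; the witness is the state that follows the last fully expanded one on the path. -/
theorem Invariant.exists_opened_key_le {s₀ : S} {σ : SearchState S Act K}
    (H : P.Invariant s₀ [] σ) (hε : 1 ≤ P.ε) (hcons : P.Consistent) {s : S} {x : ℝ≥0}
    (hp : P.PathCost P.start s x) (hs : s ∉ σ.closed 0) :
    ∃ u ∈ σ.opened 0, P.key σ u ≤ P.ε * (x + P.h s) := by
  induction hp with
  | nil =>
    exact ⟨_, H.mem_opened _ (by simp [H.start_eq]) hs, by simp [key, H.start_eq]⟩
  | @snoc t u x a hp he ih =>
    by_cases ht : t ∈ σ.closed 0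
    · have h1 : σ.g u ≤ σ.g t + P.cost t a u :=
        (H.relaxed_of_closed t ht a u he hs).resolve_left (by simp)
      have h2 : σ.g u ≤ P.ε * x + P.cost t a u :=
        h1.trans (by gcongr; exact H.closed_le t ht x hp)
      refine ⟨u, H.mem_opened u (ne_top_of_le_ne_top ?_ h2) hs, ?_⟩
      · exact_mod_cast ENNReal.coe_ne_top (r := P.ε * x + P.cost t a u)
      · calc P.key σ u ≤ (P.ε * x + P.cost t a u) + P.ε * P.h u := by unfold key; gcongr
          _ ≤ (P.ε * x + P.ε * P.cost t a u) + P.ε * P.h u := by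
            gcongr
            exact le_mul_of_one_le_left zero_le (by exact_mod_cast hε)
          _ = P.ε * (((x + P.cost t a u : ℝ≥0) : ℝ≥0∞) + P.h u) := by push_cast; ring
    · obtain ⟨v, hv, hle⟩ := ih ht
      refine ⟨v, hv, hle.trans ?_⟩
      have h : x + P.h t ≤ x + P.cost t a u + P.h u := by
        rw [add_assoc]
        exact add_le_add_right (hcons t a u he) x
      exact mul_le_mul_right (by exact_mod_cast h) _

/-! ### Expansions preserve the invariant -/

theorem Invariant.relax {s : S} {e : Act × S} {l : List (Act × S)} {σ : SearchState S Act K}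
    (H : P.Invariant s (e :: l) σ) : P.Invariant s l (P.relax s σ e) := by
  classical
  have hedge := H.edge_of_mem e (by simp)
  have hinc : ∀ t, (Function.update σ.inc e.2 ∅ t).Nonempty →
      t ≠ e.2 ∧ Function.update σ.inc e.2 ∅ t = σ.inc t := by
    intro t ht
    have hne : t ≠ e.2 := by
      rintro rfl
      simp at ht
    exact ⟨hne, Function.update_of_ne hne _ _⟩
  have hsub : ∀ t, Function.update σ.inc e.2 ∅ t ⊆ P.candidates t := by
    intro t
    rcases (Function.update σ.inc e.2 ∅ t).eq_empty_or_nonempty with h | h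
    · simp [h]
    · rw [(hinc t h).2]
      exact H.inc_subset t
  unfold PlanningProblem.relax
  split_ifs with hc
  · obtain ⟨⟨i, hi⟩, hlt⟩ := hc
    have hopen : e.2 ∉ σ.closed 0 := fun h => hi (H.mem_closed _ h i)
    -- The value of the expanded state itself never changes, since `g s + c < g s` is impossible.
    have hne : s ≠ e.2 := by
      intro h
      rw [← h] at hlt
      exact absurd hlt (not_lt.2 le_self_add)
    have hle : ∀ u, Function.update σ.g e.2 (σ.g s + P.cost s e.1 e.2) u ≤ σ.g u := by
      intro u
      by_cases h : u = e.2
      · subst h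
        simpa using hlt.le
      · rw [Function.update_of_ne h]
    have hkeep : ∀ {t a u}, t ≠ e.2 →
        (t = s ∧ (a, u) ∈ e :: l) ∨ σ.g u ≤ σ.g t + P.cost t a u →
        (t = s ∧ (a, u) ∈ l) ∨ Function.update σ.g e.2 (σ.g s + P.cost s e.1 e.2) u ≤
          Function.update σ.g e.2 (σ.g s + P.cost s e.1 e.2) t + P.cost t a u := by
      intro t a u ht h
      rw [Function.update_of_ne ht]
      rcases h with ⟨rfl, h⟩ | h
      · rcases List.mem_cons.1 h with rfl | h
        · exact .inr (by simp)
        · exact .inl ⟨rfl, h⟩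
      · exact .inr ((hle u).trans h)
    refine ⟨?_, ?_, ?_, ?_, ?_, H.mem_closed, ?_, H.goal_not_mem, hsub, ?_, ?_, ?_⟩
    · intro t x hx
      by_cases h : t = e.2
      · subst h
        simp only [Function.update_self] at hx
        have hfin : σ.g s ≠ ∞ := fun h => by simp [h] at hx
        lift σ.g s to ℝ≥0 using hfin with y hy
        obtain rfl : y + P.cost s e.1 e.2 = x := by exact_mod_cast hx
        exact .snoc (H.pathCost s y hy.symm) hedge
      · exact H.pathCost t x (by simpa [Function.update_of_ne h] using hx)
    · exact le_antisymm ((hle _).trans H.start_eq.le) zero_le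
    · rintro j t (rfl | ht)
      · simpa using (hlt.trans_le le_top).ne
      · exact ne_top_of_le_ne_top (H.opened_ne_top j t ht) (hle t)
    · intro t ht hcl
      by_cases h : t = e.2
      · exact .inl h
      · exact .inr (H.mem_opened t (by simpa [Function.update_of_ne h] using ht) hcl)
    · rintro t (rfl | ht)
      · exact hopen
      · exact H.not_mem_closed t ht
    · intro t ht x hx
      exact (hle t).trans (H.closed_le t ht x hx)
    · intro t ht a u he hu
      exact hkeep (fun h => hopen (h ▸ ht)) (H.relaxed_of_closed t ht a u he hu)
    · intro t ht a ha u he hu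
      obtain ⟨h1, h2⟩ := hinc t ht
      simp only [h2] at ht ha
      exact hkeep h1 (H.relaxed_of_inc t ht a ha u he hu)
    · exact fun e' he' => H.edge_of_mem e' (by simp [he'])
  · have hkeep : ∀ {t a u}, u ∉ σ.closed 0 →
        (t = s ∧ (a, u) ∈ e :: l) ∨ σ.g u ≤ σ.g t + P.cost t a u →
        (t = s ∧ (a, u) ∈ l) ∨ σ.g u ≤ σ.g t + P.cost t a u := by
      rintro t a u hu (⟨rfl, h⟩ | h)
      · rcases List.mem_cons.1 h with rfl | h
        · exact .inr (not_lt.1 fun hlt => hc ⟨⟨0, hu⟩, hlt⟩)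
        · exact .inl ⟨rfl, h⟩
      · exact .inr h
    exact
      { H with
        inc_subset := hsub
        relaxed_of_closed := fun t ht a u he hu => hkeep hu (H.relaxed_of_closed t ht a u he hu)
        relaxed_of_inc := by
          intro t ht a ha u he hu
          obtain ⟨-, h2⟩ := hinc t ht
          simp only [h2] at ht ha
          exact hkeep hu (H.relaxed_of_inc t ht a ha u he hu)
        edge_of_mem := fun e' he' => H.edge_of_mem e' (by simp [he']) }

theorem Invariant.foldl_relax {s : S} {l : List (Act × S)} {σ : SearchState S Act K}
    (H : P.Invariant s l σ) : P.Invariant s [] (l.foldl (P.relax s) σ) := by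
  induction l generalizing σ with
  | nil => exact H
  | cons e l ih => exact ih H.relax

theorem Invariant.actions_subset {s₀ : S} {l : List (Act × S)} {σ : SearchState S Act K}
    (H : P.Invariant s₀ l σ) (s : S) : P.actions σ s ⊆ P.candidates s := by
  unfold actions
  split_ifs
  · exact H.inc_subset s
  · exact subset_rfl

/-- An edge out of `s` whose action is not considered in an expansion of `s` was relaxed before, with
the current value of `s`. -/
theorem Invariant.relaxed_of_not_mem_actions {s₀ s u : S} {a : Act} {σ : SearchState S Act K}
    (H : P.Invariant s₀ [] σ) (ha : a ∉ P.actions σ s) (he : P.Edge s a u) (hu : u ∉ σ.closed 0) :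
    σ.g u ≤ σ.g s + P.cost s a u := by
  unfold actions at ha
  split_ifs at ha with hne
  · exact (H.relaxed_of_inc s hne a ha u he hu).resolve_left (by simp)
  · exact absurd he.1 ha

theorem edge_of_succ {i : Fin (K + 1)} {s u : S} {a : Act} (ha : a ∈ P.candidates s)
    (h : P.succ i s a = some u) : P.Edge s a u := by
  classical
  refine ⟨ha, ?_⟩
  unfold succ at h
  split_ifs at h
  · unfold fullSucc at h
    split_ifs at h with hne
    refine ⟨_, ?_, Option.some.inj h⟩
    simpa [accurate] using Finset.max'_mem _ hne.2
  · unfold partialSucc at h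
    split_ifs at h with hpre
    exact ⟨i, hpre, by simpa using h⟩

/-- A full expansion finds every edge, because accurate models agree. -/
theorem succ_zero_of_edge (hagree : P.ModelsAgree) {s u : S} {a : Act} (he : P.Edge s a u) :
    P.succ 0 s a = some u := by
  classical
  obtain ⟨ha, i, hi, rfl⟩ := he
  have hne : s ∈ P.skillPre a ∧ (P.accurate s a).Nonempty :=
    ⟨(Finset.mem_filter.1 ha).2, i, by simpa [accurate] using hi⟩
  simp only [succ, if_true, fullSucc, dif_pos hne, Option.some.injEq]
  exact hagree _ _ _ _ (by simpa [accurate] using Finset.max'_mem _ hne.2) hi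

theorem succ_of_edge (hagree : P.ModelsAgree) {i : Fin (K + 1)} (hi0 : i ≠ 0) {s u : S} {a : Act}
    (hpre : (s, a) ∈ P.modelPre i) (he : P.Edge s a u) : P.succ i s a = some u := by
  obtain ⟨-, j, hj, rfl⟩ := he
  simp only [succ, if_neg hi0, partialSucc, if_pos hpre, Option.some.injEq]
  exact hagree _ _ _ _ hpre hj

theorem mem_filterMap_succ {i : Fin (K + 1)} {s u : S} {a : Act} {l : List Act} :
    (a, u) ∈ (l.filterMap fun a => (P.succ i s a).map fun s' => (a, s')) ↔
      a ∈ l ∧ P.succ i s a = some u := by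
  simp only [List.mem_filterMap, Option.map_eq_some_iff, Prod.mk.injEq]
  constructor
  · rintro ⟨b, hb, v, hv, rfl, rfl⟩
    exact ⟨hb, hv⟩
  · rintro ⟨ha, hu⟩
    exact ⟨a, ha, u, hu, rfl, rfl⟩

/-- A state of least priority in the queue `0` has an `ε`-optimal value. -/
theorem Invariant.g_le_of_selects {s₀ s : S} {σ : SearchState S Act K} (H : P.Invariant s₀ [] σ)
    (hε : 1 ≤ P.ε) (hcons : P.Consistent) (hsel : P.Selects σ 0 s) {x : ℝ≥0}
    (hp : P.PathCost P.start s x) : σ.g s ≤ P.ε * x := by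
  obtain ⟨u, hu, hle⟩ := H.exists_opened_key_le hε hcons hp (H.not_mem_closed s hsel.1)
  have h : P.key σ s ≤ P.ε * (x + P.h s) := by
    rw [hsel.2.1]
    exact (iInf₂_le u hu).trans hle
  rw [key, mul_add] at h
  exact (ENNReal.add_le_add_iff_right (ENNReal.mul_ne_top (by simp) (by simp))).1 h

theorem Invariant.prepare {s₀ s : S} {i : Fin (K + 1)} {l : List Act} {σ : SearchState S Act K}
    (H : P.Invariant s₀ [] σ) (hagree : P.ModelsAgree) (hε : 1 ≤ P.ε) (hcons : P.Consistent)
    (hsel : P.Selects σ i s) (hs : s ∉ P.goal) (hl : ∀ a, a ∈ l ↔ a ∈ P.actions σ s) :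
    P.Invariant s (l.filterMap fun a => (P.succ i s a).map fun s' => (a, s'))
      (P.prepare σ i s) := by
  classical
  have hedge : ∀ e ∈ (l.filterMap fun a => (P.succ i s a).map fun s' => (a, s')),
      P.Edge s e.1 e.2 := by
    rintro ⟨a, u⟩ he
    obtain ⟨ha, hu⟩ := mem_filterMap_succ.1 he
    exact edge_of_succ (H.actions_subset s ((hl a).1 ha)) hu
  have hold : ∀ t ∈ (P.prepare σ i s).opened 0, t ∈ σ.opened 0 := by
    intro t ht
    by_cases hi : i = 0
    · subst hi
      simp only [PlanningProblem.prepare, Function.update_self] at ht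
      exact ht.1
    · simpa [PlanningProblem.prepare, Function.update_of_ne (Ne.symm hi)] using ht
  have hopened : ∀ j, ∀ t ∈ (P.prepare σ i s).opened j, σ.g t ≠ ∞ := by
    intro j t ht
    refine H.opened_ne_top j t ?_
    by_cases hj : j = i
    · subst hj
      simp only [PlanningProblem.prepare, Function.update_self] at ht
      exact ht.1
    · simpa [PlanningProblem.prepare, Function.update_of_ne hj] using ht
  by_cases hi : i = 0
  · subst hi
    refine ⟨H.pathCost, H.start_eq, hopened, ?_, ?_, ?_, ?_, ?_, ?_, ?_, ?_, hedge⟩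
    · intro t ht hcl
      simp only [PlanningProblem.prepare, if_true, Set.mem_insert_iff, not_or] at hcl
      simpa [PlanningProblem.prepare, hcl.1] using H.mem_opened t ht hcl.2
    · intro t ht
      simp only [PlanningProblem.prepare, Function.update_self, Set.mem_sdiff,
        Set.mem_singleton_iff] at ht
      simpa [PlanningProblem.prepare, ht.2] using H.not_mem_closed t ht.1
    · intro t ht j
      simp only [PlanningProblem.prepare, if_true, Set.mem_insert_iff] at ht ⊢
      exact ht.imp_right fun h => H.mem_closed t h j
    · intro t ht x hx
      simp only [PlanningProblem.prepare, if_true, Set.mem_insert_iff] at ht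
      rcases ht with rfl | ht
      · exact H.g_le_of_selects hε hcons hsel hx
      · exact H.closed_le t ht x hx
    · intro t ht
      have hts : t ≠ s := fun h => hs (h ▸ ht)
      simpa [PlanningProblem.prepare, hts] using H.goal_not_mem t ht
    · simpa [PlanningProblem.prepare] using H.inc_subset
    · intro t ht a u he hu
      simp only [PlanningProblem.prepare, if_true, Set.mem_insert_iff, not_or] at ht hu
      rcases ht with rfl | ht
      · by_cases ha : a ∈ P.actions σ t
        · exact .inl ⟨rfl, mem_filterMap_succ.2 ⟨(hl a).2 ha, succ_zero_of_edge hagree he⟩⟩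
        · exact .inr (H.relaxed_of_not_mem_actions ha he hu.2)
      · exact .inr ((H.relaxed_of_closed t ht a u he hu.2).resolve_left (by simp))
    · intro t ht a ha u he hu
      simp only [PlanningProblem.prepare, if_true, Set.mem_insert_iff, not_or] at ht ha hu
      exact .inr ((H.relaxed_of_inc t ht a ha u he hu.2).resolve_left (by simp))
  · have hclosed : (P.prepare σ i s).closed 0 = σ.closed 0 := by
      simp [PlanningProblem.prepare, hi, Function.update_of_ne (Ne.symm hi)]
    have hopened0 : (P.prepare σ i s).opened 0 = σ.opened 0 := by
      simp [PlanningProblem.prepare, Function.update_of_ne (Ne.symm hi)]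
    have hincs : (P.prepare σ i s).inc s =
        σ.inc s ∪ (P.actions σ s).filter fun a => (s, a) ∉ P.modelPre i := by
      simp [PlanningProblem.prepare, hi]
    have hinc : ∀ t, t ≠ s → (P.prepare σ i s).inc t = σ.inc t := by
      intro t ht
      simp [PlanningProblem.prepare, hi, Function.update_of_ne ht]
    refine ⟨H.pathCost, H.start_eq, hopened, ?_, ?_, ?_, ?_, ?_, ?_, ?_, ?_, hedge⟩
    · rw [hclosed, hopened0]
      exact H.mem_opened
    · rw [hclosed, hopened0]
      exact H.not_mem_closed
    · intro t ht j
      rw [hclosed] at ht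
      have := H.mem_closed t ht j
      by_cases hj : j = i
      · subst hj
        simp [PlanningProblem.prepare, hi, this]
      · simpa [PlanningProblem.prepare, hi, Function.update_of_ne hj] using this
    · rw [hclosed]
      exact H.closed_le
    · rw [hclosed]
      exact H.goal_not_mem
    · intro t
      by_cases hts : t = s
      · subst hts
        rw [hincs]
        exact Finset.union_subset (H.inc_subset t)
          ((Finset.filter_subset _ _).trans (H.actions_subset t))
      · rw [hinc t hts]
        exact H.inc_subset t
    · rw [hclosed]
      exact fun t ht a u he hu =>
        .inr ((H.relaxed_of_closed t ht a u he hu).resolve_left (by simp))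
    · rw [hclosed]
      intro t ht a ha u he hu
      by_cases hts : t = s
      · subst hts
        rw [hincs] at ha
        by_cases hact : a ∈ P.actions σ t
        · have hpre : (t, a) ∈ P.modelPre i := by
            by_contra hpre
            exact ha (Finset.mem_union_right _ (Finset.mem_filter.2 ⟨hact, hpre⟩))
          exact .inl ⟨rfl, mem_filterMap_succ.2 ⟨(hl a).2 hact, succ_of_edge hagree hi hpre he⟩⟩
        · exact .inr (H.relaxed_of_not_mem_actions hact he hu)
      · rw [hinc t hts] at ht ha
        exact .inr ((H.relaxed_of_inc t ht a ha u he hu).resolve_left (by simp))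

theorem Invariant.step {s₀ : S} {σ σ' : SearchState S Act K} (H : P.Invariant s₀ [] σ)
    (hagree : P.ModelsAgree) (hε : 1 ≤ P.ε) (hcons : P.Consistent) (hstep : P.Step σ σ') :
    P.Invariant s₀ [] σ' := by
  obtain ⟨i, s, l, hsel, hs, -, hl, rfl⟩ := hstep
  exact (H.prepare hagree hε hcons hsel hs hl).foldl_relax.change s₀

theorem Occurs.invariant {σ : SearchState S Act K} (hσ : P.Occurs σ) (hagree : P.ModelsAgree)
    (hε : 1 ≤ P.ε) (hcons : P.Consistent) (s : S) : P.Invariant s [] σ := by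
  induction hσ with
  | refl => exact invariant_init s
  | tail _ hstep ih => exact ih.step hagree hε hcons hstep

/-! ### Termination -/

theorem Admissible.h_eq_zero (hadm : P.Admissible) {t : S} (ht : t ∈ P.goal) : P.h t = 0 := by
  have h : (P.h t : ℝ≥0∞) ≤ (0 : ℝ≥0) := (hadm t t ht).trans (iInf₂_le 0 (.nil t))
  exact le_antisymm (by exact_mod_cast h) zero_le

/-- As long as no goal is returned, the queue `0` holds a state whose priority is bounded by the
inflated cost of any given path to a goal. -/
theorem Invariant.exists_opened_key_le_goal {s₀ : S} {σ : SearchState S Act K}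
    (H : P.Invariant s₀ [] σ) (hε : 1 ≤ P.ε) (hadm : P.Admissible) (hcons : P.Consistent) {t : S}
    (ht : t ∈ P.goal) {x : ℝ≥0} (hp : P.PathCost P.start t x) :
    ∃ u ∈ σ.opened 0, P.key σ u ≤ P.ε * x := by
  simpa [hadm.h_eq_zero ht] using H.exists_opened_key_le hε hcons hp (H.goal_not_mem t ht)

theorem Invariant.g_le_of_selects_goal {s₀ : S} {σ : SearchState S Act K}
    (H : P.Invariant s₀ [] σ) (hε : 1 ≤ P.ε) (hw_pos : ∀ i, 0 < P.w i)
    (hadm : P.Admissible) (hcons : P.Consistent) {i : Fin (K + 1)} {s t : S}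
    (hsel : P.Selects σ i s) (ht : t ∈ P.goal) :
    σ.g s ≤ ((P.w 0 / P.minWeight * P.ε : ℝ≥0) : ℝ≥0∞) * P.gStar t := by
  have hmin : 0 < P.minWeight := (Finset.lt_inf'_iff _).2 fun i _ => hw_pos i
  have hC : 0 < P.w 0 / P.minWeight * P.ε :=
    mul_pos (div_pos (hw_pos 0) hmin) (zero_lt_one.trans_le hε)
  rw [mul_comm, ← ENNReal.div_le_iff (by exact_mod_cast hC.ne') ENNReal.coe_ne_top]
  refine le_iInf₂ fun x hp => ?_
  rw [ENNReal.div_le_iff (by exact_mod_cast hC.ne') ENNReal.coe_ne_top]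
  obtain ⟨u, hu, hle⟩ := H.exists_opened_key_le_goal hε hadm hcons ht hp
  have h : (P.minWeight : ℝ≥0∞) * σ.g s ≤ P.w 0 * (P.ε * x) :=
    calc (P.minWeight : ℝ≥0∞) * σ.g s ≤ P.w i * P.key σ s := by
          gcongr
          · exact Finset.inf'_le _ (Finset.mem_univ i)
          · exact le_self_add
      _ = P.w i * P.minKey σ i := by rw [hsel.2.1]
      _ ≤ P.w 0 * P.minKey σ 0 := hsel.2.2 0
      _ ≤ P.w 0 * (P.ε * x) := by
          gcongr
          exact (iInf₂_le u hu).trans hle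
  have hfin := H.opened_ne_top i s hsel.1
  lift σ.g s to ℝ≥0 using hfin with y hy
  have h' : P.minWeight * y ≤ P.w 0 * (P.ε * x) := by exact_mod_cast h
  have h'' : y ≤ x * (P.w 0 / P.minWeight * P.ε) := by
    rw [← mul_le_mul_iff_right₀ hmin]
    refine h'.trans_eq ?_
    field_simp
  exact_mod_cast h''

end PlanningProblem

theorem theorem2 {S Act : Type*} {K : ℕ} (P : PlanningProblem S Act K)
    (hagree : P.ModelsAgree) (hε : 1 < P.ε)
    (hw_pos : ∀ i, 0 < P.w i) (hw_anti : ∀ i j, i < j → P.w j ≤ P.w i)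
    (hadm : P.Admissible) (hcons : P.Consistent) :
    (∀ (σ : PlanningProblem.SearchState S Act K) (sg : S), P.Returns σ sg →
      (∃ x : ℝ≥0, P.PathCost P.start sg x ∧ σ.g sg = x) ∧
      σ.g sg ≤ ((P.w 0 / P.minWeight * P.ε : ℝ≥0) : ℝ≥0∞) * P.gStar sg ∧
      ∀ t ∈ P.goal, σ.g sg ≤ ((P.w 0 / P.minWeight * P.ε : ℝ≥0) : ℝ≥0∞) * P.gStar t) ∧
    (∀ σ : PlanningProblem.SearchState S Act K, P.Exhausts σ →
      ∀ t ∈ P.goal, P.gStar t = ∞) := by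
  refine ⟨fun σ sg hret => ?_, fun σ hexh t ht => ?_⟩
  · obtain ⟨hocc, ⟨i, hsel⟩, hgoal⟩ := hret
    have H := hocc.invariant hagree hε.le hcons P.start
    refine ⟨?_, H.g_le_of_selects_goal hε.le hw_pos hadm hcons hsel hgoal,
      fun t ht => H.g_le_of_selects_goal hε.le hw_pos hadm hcons hsel ht⟩
    have hx : σ.g sg = ((σ.g sg).toNNReal : ℝ≥0∞) :=
      (ENNReal.coe_toNNReal (H.opened_ne_top i sg hsel.1)).symm
    exact ⟨_, H.pathCost sg _ hx, hx⟩
  · have H := hexh.1.invariant hagree hε.le hcons P.start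
    refine iInf₂_eq_top.2 fun x hp => ?_
    obtain ⟨u, hu, -⟩ := H.exists_opened_key_le_goal hε.le hadm hcons ht hp
    simp [hexh.2 0] at hu
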